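/- Let $X\neq\{0\}$ be a complex Banach space that is finite-dimensional or a Hilbert space, let $E=\ell^2(\mathbb Z,X)$ with norm $\|x\|=(\sum_{j\in\mathbb Z}\|x_j\|_X^2)^{1/2}$, and let $L(E)$ be the space of bounded linear operators on $E$. **Notation.** Every $B\in L(E)$ has a matrix representation $[b_{i,j}]_{i,j\in\mathbb Z}$, $b_{i,j}\in L(X)$, where $b_{i,j}x$ is the $i$-th entry of $B$ applied to the sequence with $j$-th entry $x$ and all other entries $0$. $B$ is banded with band-width $w$ if $b_{i,j}=0$ whenever $|i-j|>w$, and tridiagonal if it is banded with band-width $1$; $BO(E)$ is the set of all banded operators, and $BDO(E)$, the set of band-dominated operators, is its closure in the operator norm. With the conventions $\|B^{-1}\|:=\infty$ if $B$ is not invertible and $1/\infty:=0$, put $\mathrm{Spec}_\varepsilon B:=\{\lambda\in\mathbb C: 1/\|(B-\lambda I)^{-1}\|\le\varepsilon\}$ for $\varepsilon>0$ and $\mathrm{Spec}_0B:=\mathrm{Spec}\,B$. The lower norm of an operator $C$ is $\nu(C):=\inf_{\|x\|=1}\|Cx\|$. Let $B^*$ be the Banach space adjoint of $B$, acting on $E^*=\ell^2(\mathbb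 Z,X^*)$, and for $n\in\mathbb N=\{1,2,\dots\}$, $k\in\mathbb Z$ let $E_{n,k}$ be the subspace of sequences (in $E$, respectively in $E^*$) supported in $\{k+1,\dots,k+n\}$. Put $$\mu_n(B):=\inf_{k\in\mathbb Z}\min\big(\nu(B|_{E_{n,k}}),\nu(B^*|_{E_{n,k}})\big),\qquad \Gamma^n_\varepsilon(B):=\{\lambda\in\mathbb C:\mu_n(B-\lambda I)\le\varepsilon\}\quad(\varepsilon\ge0),$$ $$r(B):=\sup_{i\in\mathbb Z}\|b_{i+1,i}\|+\sup_{i\in\mathbb Z}\|b_{i-1,i}\|,\qquad \varepsilon''_n(B):=2\,r(B)\sin\frac{\pi}{2(n+1)}.$$ For $b\in\mathbb N$ give $X^b$ the norm $(\sum_{j=1}^b\|\xi_j\|_X^2)^{1/2}$ and let $\mathcal I_b:\ell^2(\mathbb Z,X)\to\ell^2(\mathbb Z,X^b)$ be the isometric isomorphism $x\mapsto\xi$, $\xi_i=(x_{bi+1},\dots,x_{b(i+1)})$. The notions above are used in the same way for operators on $\ell^2(\mathbb Z,X^b)$. For non-empty bounded $S_n,S\subset\mathbb C$, write $S_n\to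 S$ in the Hausdorff sense if $\max\big(\sup_{s\in S_n}\mathrm{dist}(s,S),\sup_{s\in S}\mathrm{dist}(s,S_n)\big)\to0$ as $n\to\infty$. **Theorem.** Let $A\in BDO(E)$, let $(A^{(n)})_{n\in\mathbb N}\subset BO(E)$ be such that $\delta_n:=\|A-A^{(n)}\|\to0$ as $n\to\infty$, let $w_n\ge1$ be a band-width of $A^{(n)}$, and let $A_n:=\mathcal I_{w_n}A^{(n)}\mathcal I_{w_n}^{-1}$. Then $A_n$ is tridiagonal for every $n\in\mathbb N$, and, for every $\varepsilon\ge0$ and $n\in\mathbb N$, $$\mathrm{Spec}_\varepsilon A\ \subset\ \Gamma^n_{\varepsilon+\delta_n+\varepsilon''_n(A_n)}(A_n)\ \subset\ \mathrm{Spec}_{\varepsilon+2\delta_n+\varepsilon''_n(A_n)}A.$$ Moreover, for every $\varepsilon\ge0$, the sets involved are non-empty and bounded and $\Gamma^n_{\varepsilon+\delta_n+\varepsilon''_n(A_n)}(A_n)\to\mathrm{Spec}_\varepsilon A$ in the Hausdorff sense as $n\to\infty$; in particular $\Gamma^n_{\delta_n+\varepsilon''_n(A_n)}(A_n)\to\mathrm{Spec}\,A$.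 -/

import Mathlib

open Filter Topology

noncomputable section

namespace BandDominated

/-! ### The spectrum, closed pseudospectra and the lower norm -/

section Pseudospectra

variable {Y Z : Type*} [NormedAddCommGroup Y] [NormedSpace ℂ Y]
  [NormedAddCommGroup Z] [NormedSpace ℂ Z]

open Classical in
/-- `1 / ‖B⁻¹‖`, with the convention that this is `0` if `B` is not invertible. -/
def recipNormInv (B : Y →L[ℂ] Y) : ℝ :=
  if IsUnit B then 1 / ‖Ring.inverse B‖ else 0

open Classical in
/-- The closed `ε`-pseudospectrum: `{λ : 1 / ‖(B - λ I)⁻¹‖ ≤ ε}` for `ε > 0`, and the spectrum of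
`B` for `ε = 0` (only `ε ≥ 0` is meaningful). -/
def Specc (ε : ℝ) (B : Y →L[ℂ] Y) : Set ℂ :=
  if 0 < ε then {z : ℂ | recipNormInv (B - z • ContinuousLinearMap.id ℂ Y) ≤ ε}
  else spectrum ℂ B

/-- The lower norm `ν(B) = inf {‖B x‖ : ‖x‖ = 1}` (the domain is meant to be nontrivial). -/
def lowerNorm (B : Y →L[ℂ] Z) : ℝ :=
  ⨅ x : {x : Y // ‖x‖ = 1}, ‖B x‖

end Pseudospectra

/-- Hausdorff convergence `S n → T` of non-empty bounded subsets of `ℂ` as `n → ∞`. For such sets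
`Metric.hausdorffDist` is the maximum of the two one-sided suprema of distances. -/
def HausdorffTendsto (S : ℕ+ → Set ℂ) (T : Set ℂ) : Prop :=
  (∀ n, (S n).Nonempty ∧ Bornology.IsBounded (S n)) ∧ T.Nonempty ∧ Bornology.IsBounded T ∧
    Tendsto (fun n => Metric.hausdorffDist (S n) T) atTop (𝓝 0)

/-! ### The space `ℓ²(ℤ, X)` and matrix representations -/

/-- `ℓ²(ℤ, X)`. -/
abbrev EllTwo (X : Type*) [NormedAddCommGroup X] := lp (fun _ : ℤ => X) 2

section Blocks

variable {X : Type*} [NormedAddCommGroup X]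

/-! ### Rewriting in tridiagonal block form -/

/-- `X^b` with the norm `(∑ j, ‖ξ_j‖²)^(1/2)`. -/
def Pow (X : Type*) [NormedAddCommGroup X] (b : ℕ) : Type _ := PiLp 2 (fun _ : Fin b => X)

namespace Pow

instance (b : ℕ) : NormedAddCommGroup (Pow X b) :=
  inferInstanceAs (NormedAddCommGroup (PiLp 2 (fun _ : Fin b => X)))

instance [NormedSpace ℂ X] (b : ℕ) : NormedSpace ℂ (Pow X b) :=
  inferInstanceAs (NormedSpace ℂ (PiLp 2 (fun _ : Fin b => X)))

instance [CompleteSpace X] (b : ℕ) : CompleteSpace (Pow X b) :=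
  inferInstanceAs (CompleteSpace (PiLp 2 (fun _ : Fin b => X)))

/-- The vector `(v_0, …, v_{b-1}) ∈ X^b`. -/
def mk {b : ℕ} (v : Fin b → X) : Pow X b := WithLp.toLp 2 v

/-- The components of a vector in `X^b`. -/
def get {b : ℕ} (ξ : Pow X b) : Fin b → X := WithLp.ofLp (p := 2) ξ

lemma norm_sq_eq {b : ℕ} (ξ : Pow X b) : ‖ξ‖ ^ 2 = ∑ m, ‖ξ.get m‖ ^ 2 :=
  PiLp.norm_sq_eq_of_L2 (fun _ : Fin b => X) ξ

end Pow

/-- The bijection `(i, m) ↦ b i + 1 + m`, where `m = 0, …, b - 1`. -/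
def blockIndex (b : ℕ) [NeZero b] : ℤ × Fin b ≃ ℤ :=
  (Int.divModEquiv b).symm.trans (Equiv.addRight 1)

lemma blockIndex_apply (b : ℕ) [NeZero b] (i : ℤ) (m : Fin b) :
    blockIndex b (i, m) = (b : ℤ) * i + 1 + (m : ℕ) := by
  simp [blockIndex, Int.divModEquiv]
  ring

/-- The sequence `ξ` with `ξ_i = (x_{b i + 1}, …, x_{b (i + 1)})`. -/
def blockSeq (b : ℕ) [NeZero b] (x : ℤ → X) (i : ℤ) : Pow X b :=
  Pow.mk fun m => x (blockIndex b (i, m))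

/-- The inverse of `blockSeq`: the entries of all blocks in order. -/
def unblockSeq (b : ℕ) [NeZero b] (ξ : ℤ → Pow X b) (j : ℤ) : X :=
  (ξ ((blockIndex b).symm j).1).get ((blockIndex b).symm j).2

lemma unblockSeq_blockSeq (b : ℕ) [NeZero b] (x : ℤ → X) : unblockSeq b (blockSeq b x) = x := by
  funext j
  change x (blockIndex b ((blockIndex b).symm j)) = x j
  rw [Equiv.apply_symm_apply]

lemma blockSeq_unblockSeq (b : ℕ) [NeZero b] (ξ : ℤ → Pow X b) :
    blockSeq b (unblockSeq b ξ) = ξ := by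
  funext i
  have h : ∀ m, unblockSeq b ξ (blockIndex b (i, m)) = (ξ i).get m := fun m => by
    rw [unblockSeq, Equiv.symm_apply_apply]
  simp only [blockSeq, h]
  rfl

lemma norm_blockSeq_sq (b : ℕ) [NeZero b] (x : ℤ → X) (i : ℤ) :
    ‖blockSeq b x i‖ ^ 2 = ∑ m, ‖x (blockIndex b (i, m))‖ ^ 2 :=
  Pow.norm_sq_eq _

lemma summable_blockSeq_iff (b : ℕ) [NeZero b] (x : ℤ → X) :
    (Summable fun i => ‖blockSeq b x i‖ ^ 2) ↔ Summable fun j => ‖x j‖ ^ 2 := by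
  rw [← (blockIndex b).summable_iff (f := fun j => ‖x j‖ ^ 2)]
  simp_rw [norm_blockSeq_sq]
  rw [summable_prod_of_nonneg (fun _ => by dsimp only [Function.comp, Pi.zero_apply]; positivity)]
  simp only [Function.comp_apply, tsum_fintype]
  exact ⟨fun h => ⟨fun _ => Summable.of_finite, h⟩, fun h => h.2⟩

lemma tsum_blockSeq (b : ℕ) [NeZero b] (x : ℤ → X) (hx : Summable fun j => ‖x j‖ ^ 2) :
    ∑' i, ‖blockSeq b x i‖ ^ 2 = ∑' j, ‖x j‖ ^ 2 := by
  have h0 : Summable fun c : ℤ × Fin b => ‖x (blockIndex b c)‖ ^ 2 :=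
    ((blockIndex b).summable_iff (f := fun j => ‖x j‖ ^ 2)).2 hx
  have h1 : ∑' c : ℤ × Fin b, ‖x (blockIndex b c)‖ ^ 2 = ∑' j, ‖x j‖ ^ 2 :=
    (blockIndex b).tsum_eq fun j => ‖x j‖ ^ 2
  rw [← h1, h0.tsum_prod]
  refine tsum_congr fun i => ?_
  rw [norm_blockSeq_sq, tsum_fintype]

end Blocks

section EllTwo

variable {X : Type*} [NormedAddCommGroup X]

lemma memℓp_two_iff {ι : Type*} {V : Type*} [NormedAddCommGroup V] (f : ι → V) :
    Memℓp f 2 ↔ Summable fun i => ‖f i‖ ^ 2 := by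
  rw [memℓp_gen_iff (by norm_num)]
  simp

lemma norm_sq_eq_tsum (x : EllTwo X) : ‖x‖ ^ 2 = ∑' i, ‖x i‖ ^ 2 := by
  have := lp.norm_rpow_eq_tsum (p := 2) (by norm_num) x
  simpa using this

lemma summable_norm_sq (x : EllTwo X) : Summable fun i => ‖x i‖ ^ 2 :=
  (memℓp_two_iff _).1 (lp.memℓp x)

lemma norm_sum_single_sq (x : ℤ → X) (F : Finset ℤ) :
    ‖∑ i ∈ F, (lp.single 2 i (x i) : EllTwo X)‖ ^ 2 = ∑ i ∈ F, ‖x i‖ ^ 2 := by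
  have := lp.norm_sum_single (E := fun _ : ℤ => X) (p := 2) (by norm_num) x F
  simpa using this

variable [NormedSpace ℂ X]

/-- The coordinate functional `x ↦ x i` on `ℓ²(ℤ, X)`. -/
def coord (i : ℤ) : EllTwo X →L[ℂ] X :=
  LinearMap.mkContinuous
    { toFun := fun x => x i
      map_add' := fun _ _ => rfl
      map_smul' := fun _ _ => rfl } 1
    (fun x => by
      rw [one_mul]
      exact lp.norm_apply_le_norm (by norm_num) x i)

/-- The sequence with `i`-th entry `x` and all other entries zero. -/
def single (i : ℤ) : X →L[ℂ] EllTwo X :=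
  lp.singleContinuousLinearMap ℂ (fun _ : ℤ => X) 2 i

/-- The entry `a_{i,j} ∈ L(X)` of the matrix representation of `A ∈ L(ℓ²(ℤ, X))`. -/
def entry (A : EllTwo X →L[ℂ] EllTwo X) (i j : ℤ) : X →L[ℂ] X :=
  (coord i).comp (A.comp (single j))

/-- `A` is banded with band-width `w`: `a_{i,j} = 0` whenever `|i - j| > w`. -/
def IsBandedWith (A : EllTwo X →L[ℂ] EllTwo X) (w : ℕ) : Prop :=
  ∀ i j : ℤ, (w : ℤ) < |i - j| → entry A i j = 0

variable (X) in
/-- `BO(E)`: the banded operators on `E = ℓ²(ℤ, X)`. -/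
def BO : Set (EllTwo X →L[ℂ] EllTwo X) := {A | ∃ w : ℕ, IsBandedWith A w}

variable (X) in
/-- `BDO(E)`: the band-dominated operators, the operator norm closure of `BO(E)`. -/
def BDO : Set (EllTwo X →L[ℂ] EllTwo X) := closure (BO X)

/-- The subspace `E_{n,k}` of sequences supported in `{k + 1, …, k + n}`. -/
def window (X : Type*) [NormedAddCommGroup X] [NormedSpace ℂ X] (n : ℕ) (k : ℤ) :
    Submodule ℂ (EllTwo X) where
  carrier := {x | ∀ j : ℤ, ¬ (k + 1 ≤ j ∧ j ≤ k + n) → x j = 0}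
  add_mem' := fun {x y} hx hy j hj => by
    simp [hx j hj, hy j hj]
  zero_mem' := fun _ _ => rfl
  smul_mem' := fun c x hx j hj => by
    simp [hx j hj]

/-! ### The Banach space adjoint, realised on `ℓ²(ℤ, X*)` -/

/-- The restriction of a functional on `ℓ²(ℤ, X)` to the `i`-th coordinate. -/
def dualEntry (f : StrongDual ℂ (EllTwo X)) (i : ℤ) : StrongDual ℂ X := f.comp (single i)

lemma dualEntry_apply (f : StrongDual ℂ (EllTwo X)) (i : ℤ) (x : X) :
    dualEntry f i x = f (lp.single 2 i x) := rfl

lemma exists_almost_norming (g : StrongDual ℂ X) {η : ℝ} (hη : 0 < η) :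
    ∃ x : X, ‖x‖ ≤ ‖g‖ ∧ ‖g‖ ^ 2 - η ≤ (g x).re := by
  rcases (norm_nonneg g).eq_or_lt with h0 | h0
  · exact ⟨0, by simp, by rw [← h0]; simp [hη.le]⟩
  · have hr : ‖g‖ - η / ‖g‖ < ‖g‖ := by
      have := div_pos hη h0
      linarith
    obtain ⟨x, hx1, hx2⟩ := g.exists_lt_apply_of_lt_opNorm hr
    obtain ⟨c, hc, hcx⟩ := RCLike.exists_norm_eq_mul_self (g x)
    refine ⟨((‖g‖ : ℝ) : ℂ) • c • x, ?_, ?_⟩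
    · rw [norm_smul, norm_smul, hc, Complex.norm_real, norm_norm, one_mul]
      nlinarith [norm_nonneg x]
    · have h1 : g (((‖g‖ : ℝ) : ℂ) • c • x) = ((‖g‖ * ‖g x‖ : ℝ) : ℂ) := by
        rw [map_smul, map_smul, smul_eq_mul, smul_eq_mul, ← hcx]
        push_cast
        rfl
      rw [h1, Complex.ofReal_re]
      have h2 : ‖g‖ * (‖g‖ - η / ‖g‖) = ‖g‖ ^ 2 - η := by
        field_simp
      rw [← h2]
      exact mul_le_mul_of_nonneg_left hx2.le h0.le

lemma sum_norm_dualEntry_sq_le (f : StrongDual ℂ (EllTwo X)) (F : Finset ℤ) :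
    ∑ i ∈ F, ‖dualEntry f i‖ ^ 2 ≤ ‖f‖ ^ 2 := by
  set S := ∑ i ∈ F, ‖dualEntry f i‖ ^ 2 with hS
  have hS0 : 0 ≤ S := Finset.sum_nonneg fun _ _ => by positivity
  have key : ∀ η : ℝ, 0 < η → S ≤ ‖f‖ * √S + F.card * η := by
    intro η hη
    choose x hx1 hx2 using fun i => exists_almost_norming (dualEntry f i) hη
    have h1 : S - F.card * η ≤ (f (∑ i ∈ F, (lp.single 2 i (x i) : EllTwo X))).re := by
      rw [map_sum, Complex.re_sum, hS]
      calc ∑ i ∈ F, ‖dualEntry f i‖ ^ 2 - F.card * η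
          = ∑ i ∈ F, (‖dualEntry f i‖ ^ 2 - η) := by simp
        _ ≤ ∑ i ∈ F, (f (lp.single 2 i (x i))).re := Finset.sum_le_sum fun i _ => hx2 i
    have h2 : ‖∑ i ∈ F, (lp.single 2 i (x i) : EllTwo X)‖ ≤ √S := by
      apply Real.le_sqrt_of_sq_le
      rw [norm_sum_single_sq, hS]
      exact Finset.sum_le_sum fun i _ => pow_le_pow_left₀ (norm_nonneg _) (hx1 i) 2
    have h3 := (Complex.re_le_norm _).trans
      (f.le_opNorm (∑ i ∈ F, (lp.single 2 i (x i) : EllTwo X)))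
    have h4 := mul_le_mul_of_nonneg_left h2 (norm_nonneg f)
    linarith
  have key2 : S ≤ ‖f‖ * √S := by
    refine le_of_forall_pos_le_add fun ε hε => ?_
    refine (key (ε / (F.card + 1)) (by positivity)).trans ?_
    have : (F.card : ℝ) * (ε / (F.card + 1)) ≤ ε := by
      rw [mul_div_assoc', div_le_iff₀ (by positivity)]
      nlinarith
    linarith
  have h5 : √S ^ 2 = S := Real.sq_sqrt hS0
  have h6 : √S ≤ ‖f‖ := by
    rcases (Real.sqrt_nonneg S).eq_or_lt with h | h
    · rw [← h]; exact norm_nonneg f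
    · nlinarith
  rw [← h5]
  exact pow_le_pow_left₀ (Real.sqrt_nonneg S) h6 2

lemma pairing_bound (φ : EllTwo (StrongDual ℂ X)) (x : EllTwo X) :
    Summable (fun i => ‖φ i (x i)‖) ∧ ∑' i, ‖φ i (x i)‖ ≤ ‖φ‖ * ‖x‖ := by
  have hx := summable_norm_sq x
  have hφ := summable_norm_sq φ
  have h1 := Real.summable_and_inner_le_Lp_mul_Lq_tsum_of_nonneg Real.HolderConjugate.two_two
    (f := fun i => ‖φ i‖) (g := fun i => ‖x i‖) (fun _ => norm_nonneg _) (fun _ => norm_nonneg _)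
    (by simpa using hφ) (by simpa using hx)
  have h2 : ∑' i, ‖φ i‖ * ‖x i‖ ≤ ‖φ‖ * ‖x‖ := by
    refine h1.2.trans_eq ?_
    rw [lp.norm_eq_tsum_rpow (by norm_num) φ, lp.norm_eq_tsum_rpow (by norm_num) x]
    simp
  have hle : ∀ i, ‖φ i (x i)‖ ≤ ‖φ i‖ * ‖x i‖ := fun i => (φ i).le_opNorm (x i)
  have hs := Summable.of_nonneg_of_le (fun i => norm_nonneg (φ i (x i))) hle h1.1
  exact ⟨hs, (hs.tsum_le_tsum hle h1.1).trans h2⟩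

/-- The functional `x ↦ ∑ i, φ_i(x_i)` on `ℓ²(ℤ, X)` given by `φ ∈ ℓ²(ℤ, X*)`. -/
def pairing (φ : EllTwo (StrongDual ℂ X)) : StrongDual ℂ (EllTwo X) :=
  LinearMap.mkContinuous
    { toFun := fun x => ∑' i, φ i (x i)
      map_add' := fun x y => by
        have h : ∀ i, φ i ((x + y) i) = φ i (x i) + φ i (y i) := fun i => by simp
        simp_rw [h]
        exact (pairing_bound φ x).1.of_norm.tsum_add (pairing_bound φ y).1.of_norm
      map_smul' := fun c x => by
        have h : ∀ i, φ i ((c • x) i) = c • φ i (x i) := fun i => by simp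
        simp_rw [h]
        exact (pairing_bound φ x).1.of_norm.tsum_const_smul c } ‖φ‖
    (fun x => (norm_tsum_le_tsum_norm (pairing_bound φ x).1).trans (pairing_bound φ x).2)

lemma pairing_apply (φ : EllTwo (StrongDual ℂ X)) (x : EllTwo X) :
    pairing φ x = ∑' i, φ i (x i) := rfl

lemma dualEntry_pairing (φ : EllTwo (StrongDual ℂ X)) (i : ℤ) :
    dualEntry (pairing φ) i = φ i := by
  ext x
  rw [dualEntry_apply, pairing_apply, tsum_eq_single i]
  · simp
  · intro j hj
    simp [lp.single_apply, Pi.single_eq_of_ne hj]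

lemma memℓp_dualEntry (f : StrongDual ℂ (EllTwo X)) : Memℓp (dualEntry f) 2 :=
  (memℓp_two_iff _).2
    (summable_of_sum_le (fun _ => by positivity) (sum_norm_dualEntry_sq_le f))

lemma pairing_dualEntry (f : StrongDual ℂ (EllTwo X)) :
    pairing (⟨dualEntry f, memℓp_dualEntry f⟩ : EllTwo (StrongDual ℂ X)) = f := by
  ext x
  have h := (lp.hasSum_single (p := 2) (by norm_num) x).mapL f
  rw [pairing_apply, ← h.tsum_eq]
  rfl

lemma norm_pairing_le (φ : EllTwo (StrongDual ℂ X)) : ‖pairing φ‖ ≤ ‖φ‖ :=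
  LinearMap.mkContinuous_norm_le _ (norm_nonneg _) _

/-- The isometric isomorphism of the dual space of `ℓ²(ℤ, X)` with `ℓ²(ℤ, X*)`, mapping a
functional to the sequence of its restrictions to the coordinates; the inverse maps `φ` to
`x ↦ ∑ i, φ_i(x_i)`. -/
def dualIso (X : Type*) [NormedAddCommGroup X] [NormedSpace ℂ X] :
    StrongDual ℂ (EllTwo X) ≃ₗᵢ[ℂ] EllTwo (StrongDual ℂ X) where
  toFun f := ⟨dualEntry f, memℓp_dualEntry f⟩
  invFun φ := pairing φ
  map_add' _ _ := rfl
  map_smul' _ _ := rfl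
  left_inv f := pairing_dualEntry f
  right_inv φ := by
    ext1
    funext i
    exact dualEntry_pairing φ i
  norm_map' f := by
    refine le_antisymm ?_ ?_
    · refine (sq_le_sq₀ (norm_nonneg _) (norm_nonneg f)).1 ?_
      rw [norm_sq_eq_tsum]
      exact Real.tsum_le_of_sum_le (fun _ => by positivity) (sum_norm_dualEntry_sq_le f)
    · have h := norm_pairing_le (⟨dualEntry f, memℓp_dualEntry f⟩ : EllTwo (StrongDual ℂ X))
      rw [pairing_dualEntry] at h
      exact h

/-- The Banach space adjoint `A* : f ↦ f ∘ A` of `A`, as an operator on `ℓ²(ℤ, X*)`. -/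
def adjoint (A : EllTwo X →L[ℂ] EllTwo X) :
    EllTwo (StrongDual ℂ X) →L[ℂ] EllTwo (StrongDual ℂ X) :=
  ((dualIso X).toContinuousLinearEquiv : StrongDual ℂ (EllTwo X) →L[ℂ] EllTwo (StrongDual ℂ X)).comp
    (((ContinuousLinearMap.compL ℂ (EllTwo X) (EllTwo X) ℂ).flip A).comp
      ((dualIso X).symm.toContinuousLinearEquiv :
        EllTwo (StrongDual ℂ X) →L[ℂ] StrongDual ℂ (EllTwo X)))

/-! ### The one-sided truncation (`τ₁`) method -/

/-- `μ_n(B) = inf_k min (ν(B|_{E_{n,k}}), ν(B*|_{E_{n,k}}))`, where for `B*` the subspace `E_{n,k}`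
is the one of `ℓ²(ℤ, X*)`. -/
def muTrunc (n : ℕ) (B : EllTwo X →L[ℂ] EllTwo X) : ℝ :=
  ⨅ k : ℤ, min (lowerNorm (B.comp (window X n k).subtypeL))
    (lowerNorm ((adjoint B).comp (window (StrongDual ℂ X) n k).subtypeL))

/-- `Γ^n_ε(A) = {λ : μ_n(A - λ I) ≤ ε}`. -/
def Gam (n : ℕ) (ε : ℝ) (A : EllTwo X →L[ℂ] EllTwo X) : Set ℂ :=
  {z : ℂ | muTrunc n (A - z • ContinuousLinearMap.id ℂ (EllTwo X)) ≤ ε}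

/-- `r(A) = sup_i ‖a_{i+1,i}‖ + sup_i ‖a_{i-1,i}‖`. -/
def rBound (A : EllTwo X →L[ℂ] EllTwo X) : ℝ :=
  (⨆ i : ℤ, ‖entry A (i + 1) i‖) + ⨆ i : ℤ, ‖entry A (i - 1) i‖

/-- The truncation penalty `ε''_n(A) = 2 r(A) sin (π / (2 (n + 1)))`. -/
def penalty (n : ℕ) (A : EllTwo X →L[ℂ] EllTwo X) : ℝ :=
  2 * rBound A * Real.sin (Real.pi / (2 * ((n : ℝ) + 1)))

/-- The isometric isomorphism `𝓘_b : ℓ²(ℤ, X) → ℓ²(ℤ, X^b)`, `x ↦ ξ` with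
`ξ_i = (x_{b i + 1}, …, x_{b (i + 1)})`. -/
def blockIso (X : Type*) [NormedAddCommGroup X] [NormedSpace ℂ X] (b : ℕ) [NeZero b] :
    EllTwo X ≃ₗᵢ[ℂ] EllTwo (Pow X b) where
  toFun x := ⟨blockSeq b x,
    (memℓp_two_iff _).2 ((summable_blockSeq_iff b _).2 (summable_norm_sq x))⟩
  invFun ξ := ⟨unblockSeq b ξ, (memℓp_two_iff _).2 ((summable_blockSeq_iff b _).1 (by
    rw [blockSeq_unblockSeq]
    exact summable_norm_sq ξ))⟩
  map_add' _ _ := rfl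
  map_smul' _ _ := rfl
  left_inv x := Subtype.ext (unblockSeq_blockSeq b x)
  right_inv ξ := Subtype.ext (blockSeq_unblockSeq b ξ)
  norm_map' x := by
    refine (sq_eq_sq₀ (norm_nonneg _) (norm_nonneg _)).1 ?_
    rw [norm_sq_eq_tsum, norm_sq_eq_tsum]
    exact tsum_blockSeq b x (summable_norm_sq x)

/-- `𝓘_b A 𝓘_b⁻¹`, an operator on `ℓ²(ℤ, X^b)`. -/
def blockForm (b : ℕ) [NeZero b] (A : EllTwo X →L[ℂ] EllTwo X) :
    EllTwo (Pow X b) →L[ℂ] EllTwo (Pow X b) :=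
  ((blockIso X b).toContinuousLinearEquiv : EllTwo X →L[ℂ] EllTwo (Pow X b)).comp
    (A.comp ((blockIso X b).symm.toContinuousLinearEquiv : EllTwo (Pow X b) →L[ℂ] EllTwo X))

end EllTwo

/-- The given norm on the complex Banach space `X` is a Hilbert space norm: it comes from an inner
product compatible with the given vector space structure. -/
def IsHilbertNorm (X : Type*) [NormedAddCommGroup X] [inst : NormedSpace ℂ X] : Prop :=
  ∃ ip : @InnerProductSpace ℂ X _ _, @InnerProductSpace.toNormedSpace ℂ X _ _ ip = inst

end BandDominated

end

open BandDominated

/-!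
An operator is invertible exactly when it and its adjoint are bounded below, and
`1 / ‖B⁻¹‖ = min (ν(B)) (ν(B*))`, so `1 / ‖B⁻¹‖ ≤ μ_n(B)`: restricting to windows only increases
lower norms. For the converse up to `ε''_n(B)`, fix a weight `w` supported in `{1, …, n}` and
multiply `x` by all translates of `w`. The squared norms of the products add up to `‖w‖² ‖x‖²`, and
multiplication by a translate commutes with the `s`-th diagonal of `B` up to the same construction
with the weight `w(· - s) - w`. For tridiagonal `B` the best `w` is the ground state of the discrete
Dirichlet Laplacian, for which `‖w(· ∓ 1) - w‖ / ‖w‖ = 2 sin (π / (2 (n + 1)))`.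

Passing from `A` to `A_n` costs `δ_n` by Lipschitz continuity of `1 / ‖B⁻¹‖`. The convergence then
follows by compactness: `Spec_ε A` is the intersection of the compact sets `Spec_{ε+η} A`, `η > 0`.
-/

noncomputable section

namespace BandDominated

/-! ### Lower norms -/

section LowerNorm

variable {V W : Type*} [NormedAddCommGroup V] [NormedSpace ℂ V]
  [NormedAddCommGroup W] [NormedSpace ℂ W]

lemma lowerNorm_nonneg (B : V →L[ℂ] W) : 0 ≤ lowerNorm B :=
  Real.iInf_nonneg fun _ => norm_nonneg _

lemma lowerNorm_mul_norm_le (B : V →L[ℂ] W) (x : V) : lowerNorm B * ‖x‖ ≤ ‖B x‖ := by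
  rcases eq_or_ne x 0 with rfl | hx
  · simp
  have hle : lowerNorm B ≤ ‖B ((‖x‖⁻¹ : ℂ) • x)‖ :=
    ciInf_le ⟨0, Set.forall_mem_range.2 fun _ => norm_nonneg _⟩
      (⟨_, norm_smul_inv_norm hx⟩ : {y : V // ‖y‖ = 1})
  rwa [map_smul, norm_smul, norm_inv, Complex.norm_real, norm_norm, ← div_eq_inv_mul,
    le_div_iff₀ (norm_pos_iff.2 hx)] at hle

lemma le_lowerNorm [Nontrivial V] {B : V →L[ℂ] W} {c : ℝ} (h : ∀ x, c * ‖x‖ ≤ ‖B x‖) :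
    c ≤ lowerNorm B := by
  have : Nonempty {x : V // ‖x‖ = 1} :=
    (exists_norm_eq V zero_le_one).elim fun x hx => ⟨⟨x, hx⟩⟩
  exact le_ciInf fun x => by simpa [x.2] using h x

lemma lowerNorm_le_add_norm_sub [Nontrivial V] (B C : V →L[ℂ] W) :
    lowerNorm B ≤ lowerNorm C + ‖B - C‖ := by
  refine sub_le_iff_le_add.1 (le_lowerNorm fun x => ?_)
  have hB := lowerNorm_mul_norm_le B x
  have hBC := (B - C).le_opNorm x
  have htri := norm_sub_norm_le (B x) (C x)
  rw [← sub_apply] at htri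
  linarith

lemma lowerNorm_le_lowerNorm_restrict (B : V →L[ℂ] W) (p : Submodule ℂ V) [Nontrivial p] :
    lowerNorm B ≤ lowerNorm (B.comp p.subtypeL) :=
  le_lowerNorm fun x => lowerNorm_mul_norm_le B x

lemma lowerNorm_conj (e : V ≃ₗᵢ[ℂ] W) (B : V →L[ℂ] V) :
    lowerNorm (e.toContinuousLinearEquiv.conjContinuousAlgEquiv B) = lowerNorm B :=
  ((e.toEquiv.subtypeEquiv fun x => by simp).iInf_congr fun x => by simp).symm

end LowerNorm

/-! ### The reciprocal of the norm of the inverse -/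

section RecipNormInv

variable {V W : Type*} [NormedAddCommGroup V] [NormedSpace ℂ V]
  [NormedAddCommGroup W] [NormedSpace ℂ W]

lemma recipNormInv_of_not_isUnit {B : V →L[ℂ] V} (hB : ¬ IsUnit B) : recipNormInv B = 0 :=
  if_neg hB

lemma recipNormInv_eq_lowerNorm [Nontrivial V] {B : V →L[ℂ] V} (hB : IsUnit B) :
    recipNormInv B = lowerNorm B := by
  rw [recipNormInv, if_pos hB]
  obtain ⟨u, rfl⟩ := hB
  rw [Ring.inverse_unit]
  have hpos : 0 < ‖(↑u⁻¹ : V →L[ℂ] V)‖ := norm_pos_iff.2 (Units.ne_zero _)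
  have hinv_apply : ∀ x, (↑u⁻¹ : V →L[ℂ] V) ((u : V →L[ℂ] V) x) = x :=
    DFunLike.congr_fun u.inv_mul
  have happly_inv : ∀ x, (u : V →L[ℂ] V) ((↑u⁻¹ : V →L[ℂ] V) x) = x :=
    DFunLike.congr_fun u.mul_inv
  refine le_antisymm (le_lowerNorm fun x => ?_) ?_
  · rw [div_mul_eq_mul_div, one_mul, div_le_iff₀' hpos]
    simpa only [hinv_apply] using (↑u⁻¹ : V →L[ℂ] V).le_opNorm ((u : V →L[ℂ] V) x)
  · rcases (lowerNorm_nonneg (u : V →L[ℂ] V)).eq_or_lt with h0 | h0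
    · rw [← h0]
      positivity
    rw [le_one_div h0 hpos]
    refine ContinuousLinearMap.opNorm_le_bound _ (by positivity) fun y => ?_
    rw [div_mul_eq_mul_div, one_mul, le_div_iff₀' h0]
    simpa only [happly_inv] using lowerNorm_mul_norm_le (u : V →L[ℂ] V) ((↑u⁻¹ : V →L[ℂ] V) y)

lemma recipNormInv_eq_zero_iff [Nontrivial V] {B : V →L[ℂ] V} :
    recipNormInv B = 0 ↔ ¬ IsUnit B := by
  refine ⟨fun h hB => ?_, recipNormInv_of_not_isUnit⟩
  rw [recipNormInv, if_pos hB, one_div, inv_eq_zero, norm_eq_zero] at h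
  exact (hB.ringInverse).ne_zero h

lemma recipNormInv_nonneg (B : V →L[ℂ] V) : 0 ≤ recipNormInv B := by
  rw [recipNormInv]
  split_ifs <;> positivity

lemma recipNormInv_conj [Nontrivial V] [Nontrivial W] (e : V ≃ₗᵢ[ℂ] W) (B : V →L[ℂ] V) :
    recipNormInv (e.toContinuousLinearEquiv.conjContinuousAlgEquiv B) = recipNormInv B := by
  have hunit : IsUnit (e.toContinuousLinearEquiv.conjContinuousAlgEquiv B) ↔ IsUnit B :=
    MulEquiv.isUnit_map (e.toContinuousLinearEquiv.conjContinuousAlgEquiv (𝕜 := ℂ))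
  by_cases hB : IsUnit B
  · rw [recipNormInv_eq_lowerNorm hB, recipNormInv_eq_lowerNorm (hunit.2 hB), lowerNorm_conj]
  · rw [recipNormInv_of_not_isUnit hB, recipNormInv_of_not_isUnit (mt hunit.1 hB)]

end RecipNormInv

/-! ### Invertibility in terms of an operator and its transpose -/

section DualMap

variable {V W : Type*} [NormedAddCommGroup V] [NormedSpace ℂ V]
  [NormedAddCommGroup W] [NormedSpace ℂ W]

/-- The Banach space adjoint `f ↦ f ∘ B` of a bounded operator `B`. On `ℓ²(ℤ, X)` it becomes
`adjoint B` under the identification `dualIso` of the dual space. -/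
def dualMap (B : V →L[ℂ] W) : StrongDual ℂ W →L[ℂ] StrongDual ℂ V :=
  (ContinuousLinearMap.compL ℂ V W ℂ).flip B

lemma dualMap_apply (B : V →L[ℂ] W) (f : StrongDual ℂ W) : dualMap B f = f.comp B := rfl

lemma dualMap_sub (B C : V →L[ℂ] W) : dualMap (B - C) = dualMap B - dualMap C :=
  map_sub (ContinuousLinearMap.compL ℂ V W ℂ).flip B C

lemma norm_dualMap_le (B : V →L[ℂ] W) : ‖dualMap B‖ ≤ ‖B‖ :=
  ContinuousLinearMap.opNorm_le_bound _ (norm_nonneg _) fun f => by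
    rw [dualMap_apply, mul_comm]
    exact f.opNorm_comp_le B

lemma lowerNorm_le_lowerNorm_dualMap [Nontrivial W] {B : V →L[ℂ] W}
    (hB : Function.Surjective B) : lowerNorm B ≤ lowerNorm (dualMap B) := by
  rcases (lowerNorm_nonneg B).eq_or_lt with h0 | h0
  · rw [← h0]
    exact lowerNorm_nonneg _
  refine le_lowerNorm fun f => ?_
  rw [← le_div_iff₀' h0]
  refine f.opNorm_le_bound (by positivity) fun y => ?_
  obtain ⟨x, rfl⟩ := hB y
  calc ‖f (B x)‖ ≤ ‖dualMap B f‖ * ‖x‖ := (dualMap B f).le_opNorm x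
    _ ≤ ‖dualMap B f‖ * (‖B x‖ / lowerNorm B) := by
        gcongr
        rw [le_div_iff₀' h0]
        exact lowerNorm_mul_norm_le B x
    _ = ‖dualMap B f‖ / lowerNorm B * ‖B x‖ := by ring

lemma injective_of_lowerNorm_pos {B : V →L[ℂ] W} (h : 0 < lowerNorm B) :
    Function.Injective B := by
  refine (injective_iff_map_eq_zero B).2 fun x hx => ?_
  have hle := lowerNorm_mul_norm_le B x
  rw [hx, norm_zero] at hle
  exact norm_le_zero_iff.1 (nonpos_of_mul_nonpos_right hle h)

lemma isClosed_range_of_lowerNorm_pos [CompleteSpace V] {B : V →L[ℂ] W} (h : 0 < lowerNorm B) :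
    IsClosed (Set.range B) := by
  have hanti : AntilipschitzWith (lowerNorm B)⁻¹.toNNReal B :=
    B.antilipschitz_of_bound fun x => by
      rw [Real.coe_toNNReal _ (by positivity), ← div_eq_inv_mul, le_div_iff₀' h]
      exact lowerNorm_mul_norm_le B x
  exact hanti.isClosed_range B.uniformContinuous

lemma surjective_of_injective_dualMap {B : V →L[ℂ] W} (hrange : IsClosed (Set.range B))
    (hdual : Function.Injective (dualMap B)) : Function.Surjective B := by
  intro y
  by_contra hy
  have : IsClosed (B.range : Set W) := hrange
  have hq : B.range.mkQL y ≠ 0 := (Submodule.Quotient.mk_eq_zero _).not.2 hy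
  obtain ⟨g, hg⟩ := SeparatingDual.exists_ne_zero (R := ℂ) hq
  have hgB : dualMap B (g.comp B.range.mkQL) = dualMap B 0 := by
    ext x
    have hx : B.range.mkQL (B x) = 0 := (Submodule.Quotient.mk_eq_zero _).2 ⟨x, rfl⟩
    simp [dualMap_apply, hx]
  exact hg (DFunLike.congr_fun (hdual hgB) y)

lemma isUnit_of_lowerNorm_pos [CompleteSpace V] {B : V →L[ℂ] V}
    (h : 0 < lowerNorm B) (hdual : 0 < lowerNorm (dualMap B)) : IsUnit B :=
  ContinuousLinearMap.isUnit_iff_bijective.2 ⟨injective_of_lowerNorm_pos h,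
    surjective_of_injective_dualMap (isClosed_range_of_lowerNorm_pos h)
      (injective_of_lowerNorm_pos hdual)⟩

theorem recipNormInv_eq_min [CompleteSpace V] [Nontrivial V] (B : V →L[ℂ] V) :
    recipNormInv B = min (lowerNorm B) (lowerNorm (dualMap B)) := by
  by_cases hB : IsUnit B
  · have hsurj := (ContinuousLinearMap.isUnit_iff_bijective.1 hB).surjective
    rw [min_eq_left (lowerNorm_le_lowerNorm_dualMap hsurj), recipNormInv_eq_lowerNorm hB]
  · rw [recipNormInv_of_not_isUnit hB]
    refine le_antisymm (le_min (lowerNorm_nonneg _) (lowerNorm_nonneg _)) (not_lt.1 fun h => hB ?_)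
    exact isUnit_of_lowerNorm_pos (lt_min_iff.1 h).1 (lt_min_iff.1 h).2

lemma recipNormInv_le_add_norm_sub [CompleteSpace V] [Nontrivial V] (B C : V →L[ℂ] V) :
    recipNormInv B ≤ recipNormInv C + ‖B - C‖ := by
  rw [recipNormInv_eq_min, recipNormInv_eq_min, ← min_add_add_right]
  refine min_le_min (lowerNorm_le_add_norm_sub B C)
    ((lowerNorm_le_add_norm_sub (dualMap B) (dualMap C)).trans ?_)
  rw [← dualMap_sub]
  gcongr
  exact norm_dualMap_le _

end DualMap

/-! ### Pseudospectra -/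

section Pseudospectra

variable {V W : Type*} [NormedAddCommGroup V] [NormedSpace ℂ V]
  [NormedAddCommGroup W] [NormedSpace ℂ W] {ε : ℝ}

lemma Specc_zero (A : V →L[ℂ] V) : Specc 0 A = spectrum ℂ A := if_neg (lt_irrefl 0)

variable [Nontrivial V]

lemma mem_Specc_iff (hε : 0 ≤ ε) {A : V →L[ℂ] V} {z : ℂ} :
    z ∈ Specc ε A ↔ recipNormInv (A - z • ContinuousLinearMap.id ℂ V) ≤ ε := by
  rcases hε.eq_or_lt with rfl | hε
  · rw [(recipNormInv_nonneg _).ge_iff_eq', recipNormInv_eq_zero_iff, Specc_zero,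
      spectrum.mem_iff, ← IsUnit.neg_iff, neg_sub]
    rfl
  · rw [Specc, if_pos hε, Set.mem_ofPred_eq]

lemma Specc_mono {ε' : ℝ} (hε : 0 ≤ ε) (h : ε ≤ ε') (A : V →L[ℂ] V) : Specc ε A ⊆ Specc ε' A :=
  fun _ hz => (mem_Specc_iff (hε.trans h)).2 (((mem_Specc_iff hε).1 hz).trans h)

lemma Specc_conj [Nontrivial W] (hε : 0 ≤ ε) (e : V ≃ₗᵢ[ℂ] W) (A : V →L[ℂ] V) :
    Specc ε (e.toContinuousLinearEquiv.conjContinuousAlgEquiv A) = Specc ε A := by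
  ext z
  have hsub : e.toContinuousLinearEquiv.conjContinuousAlgEquiv A - z • ContinuousLinearMap.id ℂ W =
      e.toContinuousLinearEquiv.conjContinuousAlgEquiv (A - z • ContinuousLinearMap.id ℂ V) := by
    ext; simp
  rw [mem_Specc_iff hε, mem_Specc_iff hε, hsub, recipNormInv_conj]

variable [CompleteSpace V]

lemma Specc_subset_Specc_add_norm_sub (hε : 0 ≤ ε) (A B : V →L[ℂ] V) :
    Specc ε A ⊆ Specc (ε + ‖A - B‖) B := fun z hz => by
  rw [mem_Specc_iff hε] at hz
  rw [mem_Specc_iff (by positivity)]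
  refine (recipNormInv_le_add_norm_sub _ (A - z • ContinuousLinearMap.id ℂ V)).trans ?_
  rw [sub_sub_sub_cancel_right, norm_sub_rev]
  gcongr

lemma Specc_zero_operator_subset_closedBall (hε : 0 ≤ ε) :
    Specc ε (0 : V →L[ℂ] V) ⊆ Metric.closedBall 0 ε := fun z hz => by
  rw [mem_closedBall_zero_iff]
  refine le_trans ?_ ((mem_Specc_iff hε).1 hz)
  rw [recipNormInv_eq_min]
  refine le_min (le_lowerNorm fun x => ?_) (le_lowerNorm fun f => ?_)
  · simp [norm_smul]
  · simp [dualMap_apply, norm_smul]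

lemma isBounded_Specc (hε : 0 ≤ ε) (A : V →L[ℂ] V) : Bornology.IsBounded (Specc ε A) :=
  Metric.isBounded_closedBall.subset <|
    (Specc_subset_Specc_add_norm_sub hε A 0).trans
      (Specc_zero_operator_subset_closedBall (by positivity))

lemma isClosed_Specc (hε : 0 ≤ ε) (A : V →L[ℂ] V) : IsClosed (Specc ε A) := by
  have hcont : Continuous (recipNormInv : (V →L[ℂ] V) → ℝ) :=
    (LipschitzWith.of_le_add fun B C => by
      simpa only [dist_eq_norm] using recipNormInv_le_add_norm_sub B C).continuous
  have hSpecc : Specc ε A =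
      {z : ℂ | recipNormInv (A - z • ContinuousLinearMap.id ℂ V) ≤ ε} :=
    Set.ext fun _ => mem_Specc_iff hε
  rw [hSpecc]
  exact isClosed_le (hcont.comp (by fun_prop)) continuous_const

lemma nonempty_Specc (hε : 0 ≤ ε) (A : V →L[ℂ] V) : (Specc ε A).Nonempty :=
  (Specc_zero A ▸ spectrum.nonempty A).mono (Specc_mono le_rfl hε A)

lemma exists_Specc_subset_thickening (hε : 0 ≤ ε) (A : V →L[ℂ] V) {r : ℝ} (hr : 0 < r) :
    ∃ η > 0, Specc (ε + η) A ⊆ Metric.thickening r (Specc ε A) := by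
  have hdir : Directed (· ⊇ ·) fun η : Set.Ioi (0 : ℝ) => Specc (ε + η) A :=
    directed_of_isDirected_ge fun η _ h =>
      Specc_mono (add_nonneg hε η.2.le) (add_le_add le_rfl h) A
  have hcompact (η : Set.Ioi (0 : ℝ)) : IsCompact (Specc (ε + η) A) :=
    Metric.isCompact_of_isClosed_isBounded (isClosed_Specc (add_nonneg hε η.2.le) A)
      (isBounded_Specc (add_nonneg hε η.2.le) A)
  have hinter : ⋂ η : Set.Ioi (0 : ℝ), Specc (ε + η) A ⊆ Specc ε A := fun z hz =>
    (mem_Specc_iff hε).2 <| le_of_forall_pos_le_add fun η hη =>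
      (mem_Specc_iff (add_nonneg hε hη.le)).1 (Set.mem_iInter.1 hz ⟨η, hη⟩)
  obtain ⟨η, hη⟩ := exists_subset_nhds_of_isCompact hdir hcompact fun z hz =>
    Metric.isOpen_thickening.mem_nhds (Metric.self_subset_thickening hr _ (hinter hz))
  exact ⟨η, η.2, hη⟩

theorem hausdorffTendsto_Specc (hε : 0 ≤ ε) (A : V →L[ℂ] V) {S : ℕ+ → Set ℂ} {η : ℕ+ → ℝ}
    (hη : ∀ n, 0 ≤ η n) (hη0 : Tendsto η atTop (𝓝 0)) (hsub : ∀ n, Specc ε A ⊆ S n)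
    (hsup : ∀ n, S n ⊆ Specc (ε + η n) A) : HausdorffTendsto S (Specc ε A) := by
  refine ⟨fun n => ⟨(nonempty_Specc hε A).mono (hsub n),
    (isBounded_Specc (add_nonneg hε (hη n)) A).subset (hsup n)⟩,
    nonempty_Specc hε A, isBounded_Specc hε A, ?_⟩
  refine tendsto_order.2 ⟨fun r hr => .of_forall fun _ => hr.trans_le Metric.hausdorffDist_nonneg,
    fun r hr => ?_⟩
  obtain ⟨η₀, hη₀, hthick⟩ := exists_Specc_subset_thickening hε A (half_pos hr)
  filter_upwards [hη0.eventually_lt_const hη₀] with n hn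
  refine (Metric.hausdorffDist_le_of_mem_dist (half_pos hr).le (fun z hz => ?_)
    fun z hz => ⟨z, hsub n hz, by simpa using (half_pos hr).le⟩).trans_lt (half_lt_self hr)
  have hz' := hthick (Specc_mono (add_nonneg hε (hη n)) (by gcongr) A (hsup n hz))
  obtain ⟨y, hy, hzy⟩ := Metric.mem_thickening_iff.1 hz'
  exact ⟨y, hy, hzy.le⟩

end Pseudospectra

/-! ### Matrix entries -/

section Entries

variable {Y : Type*} [NormedAddCommGroup Y] [NormedSpace ℂ Y]

instance nontrivial_ellTwo [Nontrivial Y] : Nontrivial (EllTwo Y) := by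
  obtain ⟨y, hy⟩ := exists_ne (0 : Y)
  refine nontrivial_of_ne (lp.single 2 0 y) 0 (norm_ne_zero_iff.1 ?_)
  rwa [lp.norm_single (by norm_num), norm_ne_zero_iff]

lemma entry_apply (B : EllTwo Y →L[ℂ] EllTwo Y) (i j : ℤ) (y : Y) :
    entry B i j y = B (lp.single 2 j y) i := rfl

lemma hasSum_entry (B : EllTwo Y →L[ℂ] EllTwo Y) (x : EllTwo Y) (i : ℤ) :
    HasSum (fun j => entry B i j (x j)) (B x i) :=
  (lp.hasSum_single (p := 2) (by norm_num) x).mapL ((coord i).comp B)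

lemma norm_entry_le (B : EllTwo Y →L[ℂ] EllTwo Y) (i j : ℤ) : ‖entry B i j‖ ≤ ‖B‖ :=
  ContinuousLinearMap.opNorm_le_bound _ (norm_nonneg _) fun y => by
    rw [entry_apply, ← lp.norm_single (p := 2) (E := fun _ => Y) (by norm_num) j y]
    exact (lp.norm_apply_le_norm (by norm_num) _ i).trans (B.le_opNorm _)

lemma bddAbove_norm_entry (B : EllTwo Y →L[ℂ] EllTwo Y) (f g : ℤ → ℤ) :
    BddAbove (Set.range fun i => ‖entry B (f i) (g i)‖) :=
  ⟨‖B‖, Set.forall_mem_range.2 fun _ => norm_entry_le B _ _⟩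

lemma entry_sub_smul_id (B : EllTwo Y →L[ℂ] EllTwo Y) (z : ℂ) {i j : ℤ} (hij : i ≠ j) :
    entry (B - z • ContinuousLinearMap.id ℂ (EllTwo Y)) i j = entry B i j := by
  ext y
  change B (lp.single 2 j y) i - z • (lp.single 2 j y : EllTwo Y) i = B (lp.single 2 j y) i
  rw [lp.single_apply_ne _ _ _ hij, smul_zero, sub_zero]

lemma IsBandedWith.sub_smul_id {B : EllTwo Y →L[ℂ] EllTwo Y} {b : ℕ} (hB : IsBandedWith B b)
    (z : ℂ) : IsBandedWith (B - z • ContinuousLinearMap.id ℂ (EllTwo Y)) b := by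
  intro i j hij
  have hne : i ≠ j := fun h => by simp [h] at hij; omega
  rw [entry_sub_smul_id B z hne, hB i j hij]

lemma entry_adjoint_apply (B : EllTwo Y →L[ℂ] EllTwo Y) (i j : ℤ) (g : StrongDual ℂ Y) :
    entry (adjoint B) i j g = g.comp (entry B j i) := by
  ext y
  change pairing (lp.single 2 j g) (B (lp.single 2 i y)) = g (B (lp.single 2 i y) j)
  rw [pairing_apply, tsum_eq_single j fun k hk => by simp [lp.single_apply, Pi.single_eq_of_ne hk]]
  simp

lemma norm_entry_adjoint_le (B : EllTwo Y →L[ℂ] EllTwo Y) (i j : ℤ) :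
    ‖entry (adjoint B) i j‖ ≤ ‖entry B j i‖ :=
  ContinuousLinearMap.opNorm_le_bound _ (norm_nonneg _) fun g => by
    rw [entry_adjoint_apply, mul_comm]
    exact g.opNorm_comp_le _

lemma IsBandedWith.adjoint {B : EllTwo Y →L[ℂ] EllTwo Y} {b : ℕ} (hB : IsBandedWith B b) :
    IsBandedWith (adjoint B) b := by
  intro i j hij
  ext g : 1
  simp [entry_adjoint_apply, hB j i (by rwa [abs_sub_comm])]

lemma rBound_nonneg (B : EllTwo Y →L[ℂ] EllTwo Y) : 0 ≤ rBound B :=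
  add_nonneg (Real.iSup_nonneg fun _ => norm_nonneg _) (Real.iSup_nonneg fun _ => norm_nonneg _)

lemma rBound_le_two_mul_norm (B : EllTwo Y →L[ℂ] EllTwo Y) : rBound B ≤ 2 * ‖B‖ := by
  rw [two_mul]
  exact add_le_add (ciSup_le fun _ => norm_entry_le B _ _) (ciSup_le fun _ => norm_entry_le B _ _)

lemma rBound_adjoint_le (B : EllTwo Y →L[ℂ] EllTwo Y) : rBound (adjoint B) ≤ rBound B := by
  rw [rBound, rBound, add_comm]
  refine add_le_add (ciSup_le fun i => ?_) (ciSup_le fun i => ?_)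
  · refine (norm_entry_adjoint_le B (i - 1) i).trans ?_
    simpa using le_ciSup (bddAbove_norm_entry B (· + 1) id) (i - 1)
  · refine (norm_entry_adjoint_le B (i + 1) i).trans ?_
    simpa using le_ciSup (bddAbove_norm_entry B (· - 1) id) (i + 1)

lemma rBound_sub_smul_id (B : EllTwo Y →L[ℂ] EllTwo Y) (z : ℂ) :
    rBound (B - z • ContinuousLinearMap.id ℂ (EllTwo Y)) = rBound B := by
  have hsucc (i : ℤ) : i + 1 ≠ i := by omega
  have hpred (i : ℤ) : i - 1 ≠ i := by omega
  simp only [rBound, entry_sub_smul_id B z (hsucc _), entry_sub_smul_id B z (hpred _)]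

lemma sin_pi_div_nonneg (n : ℕ) : 0 ≤ Real.sin (Real.pi / (2 * ((n : ℝ) + 1))) :=
  Real.sin_nonneg_of_nonneg_of_le_pi (by positivity)
    (div_le_self Real.pi_pos.le (by linarith [n.cast_nonneg (α := ℝ)]))

lemma penalty_nonneg (n : ℕ) (B : EllTwo Y →L[ℂ] EllTwo Y) : 0 ≤ penalty n B :=
  mul_nonneg (mul_nonneg zero_le_two (rBound_nonneg B)) (sin_pi_div_nonneg n)

lemma penalty_sub_smul_id (n : ℕ) (B : EllTwo Y →L[ℂ] EllTwo Y) (z : ℂ) :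
    penalty n (B - z • ContinuousLinearMap.id ℂ (EllTwo Y)) = penalty n B := by
  rw [penalty, penalty, rBound_sub_smul_id]

lemma penalty_adjoint_le (n : ℕ) (B : EllTwo Y →L[ℂ] EllTwo Y) :
    penalty n (adjoint B) ≤ penalty n B :=
  mul_le_mul_of_nonneg_right (mul_le_mul_of_nonneg_left (rBound_adjoint_le B) zero_le_two)
    (sin_pi_div_nonneg n)

end Entries

/-! ### Sliding windows -/

section Shift

variable {Y : Type*} [NormedAddCommGroup Y]

lemma memℓp_shift (s : ℤ) (x : EllTwo Y) : Memℓp (fun j => x (j - s)) 2 :=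
  (memℓp_two_iff _).2 ((summable_norm_sq x).comp_injective (Equiv.subRight s).injective)

variable [NormedSpace ℂ Y]

/-- The bilateral shift by `s` on `ℓ²(ℤ, Y)`. -/
def shift (s : ℤ) : EllTwo Y ≃ₗᵢ[ℂ] EllTwo Y where
  toFun x := ⟨fun j => x (j - s), memℓp_shift s x⟩
  invFun x := ⟨fun j => x (j + s),
    show Memℓp _ 2 by simpa only [sub_neg_eq_add] using memℓp_shift (-s) x⟩
  map_add' _ _ := rfl
  map_smul' _ _ := rfl
  left_inv x := by ext j; simp
  right_inv x := by ext j; simp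
  norm_map' x := by
    refine (sq_eq_sq₀ (norm_nonneg _) (norm_nonneg _)).1 ?_
    rw [norm_sq_eq_tsum, norm_sq_eq_tsum]
    exact (Equiv.subRight s).tsum_eq fun j => ‖x j‖ ^ 2

lemma shift_apply (s : ℤ) (x : EllTwo Y) (j : ℤ) : shift s x j = x (j - s) := rfl

lemma memℓp_diagonal (B : EllTwo Y →L[ℂ] EllTwo Y) (s : ℤ) (x : EllTwo Y) :
    Memℓp (fun i => entry B i (i - s) (x (i - s))) 2 :=
  (lp.memℓp (‖B‖ • shift s x)).mono' fun i => by
    rw [lp.coeFn_smul, Pi.smul_apply, norm_smul, norm_norm]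
    exact (entry B i (i - s)).le_of_opNorm_le (norm_entry_le B _ _) _

/-- The `s`-th diagonal of the matrix of `B`, applied to `x`: the entries `b_{i,i-s} x_{i-s}`. -/
def diagonal (B : EllTwo Y →L[ℂ] EllTwo Y) (s : ℤ) (x : EllTwo Y) : EllTwo Y :=
  ⟨fun i => entry B i (i - s) (x (i - s)), memℓp_diagonal B s x⟩

lemma diagonal_apply (B : EllTwo Y →L[ℂ] EllTwo Y) (s : ℤ) (x : EllTwo Y) (i : ℤ) :
    diagonal B s x i = entry B i (i - s) (x (i - s)) := rfl

lemma norm_diagonal_le (B : EllTwo Y →L[ℂ] EllTwo Y) (s : ℤ) (x : EllTwo Y) :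
    ‖diagonal B s x‖ ≤ (⨆ i, ‖entry B (i + s) i‖) * ‖x‖ := by
  have hsup0 : 0 ≤ ⨆ i, ‖entry B (i + s) i‖ := Real.iSup_nonneg fun _ => norm_nonneg _
  rw [← (shift s).norm_map x, ← Real.norm_of_nonneg hsup0, ← norm_smul]
  refine lp.norm_mono two_ne_zero fun i => ?_
  rw [diagonal_apply, lp.coeFn_smul, Pi.smul_apply, norm_smul, Real.norm_of_nonneg hsup0]
  refine (entry B i (i - s)).le_of_opNorm_le ?_ _
  simpa using le_ciSup (bddAbove_norm_entry B (· + s) id) (i - s)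

lemma IsBandedWith.sum_diagonal {B : EllTwo Y →L[ℂ] EllTwo Y} {b : ℕ} (hB : IsBandedWith B b)
    (x : EllTwo Y) : B x = ∑ s ∈ Finset.Icc (-b : ℤ) b, diagonal B s x := by
  ext i
  rw [lp.coeFn_sum, Finset.sum_apply]
  refine ((Equiv.subLeft i).hasSum_iff.2 (hasSum_entry B x i)).unique
    (hasSum_sum_of_ne_finset_zero fun s hs => ?_)
  have hs' : (b : ℤ) < |i - (i - s)| := by
    rw [sub_sub_cancel, lt_abs]
    simp only [Finset.mem_Icc] at hs
    omega
  simp [hB _ _ hs']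

end Shift

section Translates

variable {Y : Type*} [NormedAddCommGroup Y] [NormedSpace ℂ Y]

/-- The bijection `(k, j) ↦ (j - k, j)`, which separates the variables of `w_{j-k} x_j`. -/
def diffEquiv : ℤ × ℤ ≃ ℤ × ℤ where
  toFun p := (p.2 - p.1, p.2)
  invFun p := (p.2 - p.1, p.2)
  left_inv p := by simp
  right_inv p := by simp

lemma hasSum_sub_mul {u v : ℤ → ℝ} (hu : Summable u) (hv : Summable v) (hu0 : 0 ≤ u)
    (hv0 : 0 ≤ v) :
    HasSum (fun p : ℤ × ℤ => u (p.2 - p.1) * v p.2) ((∑' i, u i) * ∑' i, v i) := by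
  have hprod := hu.hasSum.mul hv.hasSum (hu.mul_of_nonneg hv hu0 hv0)
  rw [← diffEquiv.hasSum_iff] at hprod
  exact hprod

lemma hasSum_norm_translates (w : EllTwo ℂ) (x : EllTwo Y) :
    HasSum (fun p : ℤ × ℤ => ‖w (p.2 - p.1) • x p.2‖ ^ 2) ((‖w‖ * ‖x‖) ^ 2) := by
  rw [mul_pow, norm_sq_eq_tsum, norm_sq_eq_tsum]
  simp only [norm_smul, mul_pow]
  exact hasSum_sub_mul (u := fun j => ‖w j‖ ^ 2) (v := fun j => ‖x j‖ ^ 2) (summable_norm_sq w)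
    (summable_norm_sq x) (fun _ => sq_nonneg _) fun _ => sq_nonneg _

lemma memℓp_translate (w : EllTwo ℂ) (x : EllTwo Y) (k : ℤ) :
    Memℓp (fun j => w (j - k) • x j) 2 :=
  (memℓp_two_iff _).2 ((hasSum_norm_translates w x).summable.prod_factor k)

lemma hasSum_norm_translate (w : EllTwo ℂ) (x : EllTwo Y) :
    HasSum (fun k => ‖(⟨_, memℓp_translate w x k⟩ : EllTwo Y)‖ ^ 2) ((‖w‖ * ‖x‖) ^ 2) := by
  simp only [norm_sq_eq_tsum]
  exact (hasSum_norm_translates w x).prod_fiberwise fun k =>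
    ((hasSum_norm_translates w x).summable.prod_factor k).hasSum

/-- The family, indexed by `k`, of the sequences `(w_{j-k} x_j)_j`: the localisations of `x` by all
translates of the weight `w`. -/
def translates (w : EllTwo ℂ) (x : EllTwo Y) : EllTwo (EllTwo Y) :=
  ⟨fun k => ⟨fun j => w (j - k) • x j, memℓp_translate w x k⟩,
    (memℓp_two_iff _).2 (hasSum_norm_translate w x).summable⟩

lemma translates_apply (w : EllTwo ℂ) (x : EllTwo Y) (k j : ℤ) :
    translates w x k j = w (j - k) • x j := rfl

lemma norm_translates (w : EllTwo ℂ) (x : EllTwo Y) : ‖translates w x‖ = ‖w‖ * ‖x‖ := by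
  refine (sq_eq_sq₀ (norm_nonneg _) (by positivity)).1 ?_
  rw [norm_sq_eq_tsum]
  exact (hasSum_norm_translate w x).tsum_eq

lemma translates_mem_window {n : ℕ} {w : EllTwo ℂ} (hw : w ∈ window ℂ n 0) (x : EllTwo Y) (k : ℤ) :
    translates w x k ∈ window Y n k := fun j hj => by
  rw [translates_apply, hw _ (by omega), zero_smul]

lemma IsBandedWith.apply_translates {B : EllTwo Y →L[ℂ] EllTwo Y} {b : ℕ} (hB : IsBandedWith B b)
    (w : EllTwo ℂ) (x : EllTwo Y) (k : ℤ) :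
    B (translates w x k) = (translates w (B x) +
      ∑ s ∈ Finset.Icc (-b : ℤ) b, translates (shift s w - w) (diagonal B s x)) k := by
  have hsum : translates w (B x) k =
      ∑ s ∈ Finset.Icc (-b : ℤ) b, translates w (diagonal B s x) k := by
    rw [hB.sum_diagonal x]
    ext j
    simp only [translates_apply, lp.coeFn_sum, Finset.sum_apply, Finset.smul_sum]
  rw [lp.coeFn_add, Pi.add_apply, hsum, lp.coeFn_sum, Finset.sum_apply, ← Finset.sum_add_distrib,
    hB.sum_diagonal]
  refine Finset.sum_congr rfl fun s _ => ?_
  ext j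
  rw [lp.coeFn_add, Pi.add_apply, diagonal_apply, translates_apply, translates_apply,
    translates_apply, map_smul, ← diagonal_apply, lp.coeFn_sub, Pi.sub_apply, shift_apply,
    ← add_smul, add_sub_cancel, sub_right_comm]

lemma iInf_lowerNorm_window_mul_le (B : EllTwo Y →L[ℂ] EllTwo Y) {n : ℕ} {k : ℤ} {x : EllTwo Y}
    (hx : x ∈ window Y n k) :
    (⨅ k, lowerNorm (B.comp (window Y n k).subtypeL)) * ‖x‖ ≤ ‖B x‖ := by
  have hbdd : BddBelow (Set.range fun k => lowerNorm (B.comp (window Y n k).subtypeL)) :=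
    ⟨0, Set.forall_mem_range.2 fun _ => lowerNorm_nonneg _⟩
  refine (mul_le_mul_of_nonneg_right (ciInf_le hbdd k) (norm_nonneg x)).trans ?_
  exact lowerNorm_mul_norm_le (B.comp (window Y n k).subtypeL) ⟨x, hx⟩

lemma IsBandedWith.iInf_lowerNorm_window_mul_le {B : EllTwo Y →L[ℂ] EllTwo Y} {b : ℕ}
    (hB : IsBandedWith B b) {n : ℕ} {w : EllTwo ℂ} (hw : w ∈ window ℂ n 0) (x : EllTwo Y) :
    (⨅ k, lowerNorm (B.comp (window Y n k).subtypeL)) * (‖w‖ * ‖x‖) ≤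
      ‖w‖ * ‖B x‖ + ∑ s ∈ Finset.Icc (-b : ℤ) b,
        ‖shift s w - w‖ * ((⨆ i, ‖entry B (i + s) i‖) * ‖x‖) := by
  -- Multiplication by a translate of `w` commutes with the `s`-th diagonal of `B` up to the weight
  -- `shift s w - w`; summing the squares over all translates loses nothing by `norm_translates`.
  set c := ⨅ k, lowerNorm (B.comp (window Y n k).subtypeL)
  have hc0 : 0 ≤ c := Real.iInf_nonneg fun _ => lowerNorm_nonneg _
  calc c * (‖w‖ * ‖x‖) = ‖c • translates w x‖ := by
        rw [norm_smul, Real.norm_of_nonneg hc0, norm_translates]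
    _ ≤ ‖translates w (B x) +
          ∑ s ∈ Finset.Icc (-b : ℤ) b, translates (shift s w - w) (diagonal B s x)‖ := by
        refine lp.norm_mono two_ne_zero fun k => ?_
        rw [← hB.apply_translates, lp.coeFn_smul, Pi.smul_apply, norm_smul,
          Real.norm_of_nonneg hc0]
        exact BandDominated.iInf_lowerNorm_window_mul_le B (translates_mem_window hw x k)
    _ ≤ ‖translates w (B x)‖ +
          ∑ s ∈ Finset.Icc (-b : ℤ) b, ‖translates (shift s w - w) (diagonal B s x)‖ :=
        norm_add_le_of_le le_rfl (norm_sum_le _ _)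
    _ ≤ _ := by
        simp only [norm_translates]
        exact add_le_add le_rfl (Finset.sum_le_sum fun s _ =>
          mul_le_mul_of_nonneg_left (norm_diagonal_le B s x) (norm_nonneg _))

theorem IsBandedWith.iInf_lowerNorm_window_le [Nontrivial Y] {B : EllTwo Y →L[ℂ] EllTwo Y} {b : ℕ}
    (hB : IsBandedWith B b) {n : ℕ} {w : EllTwo ℂ} (hw : w ∈ window ℂ n 0) (hw0 : w ≠ 0) :
    ⨅ k, lowerNorm (B.comp (window Y n k).subtypeL) ≤ lowerNorm B +
      ∑ s ∈ Finset.Icc (-b : ℤ) b,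
        (⨆ i, ‖entry B (i + s) i‖) * (‖shift s w - w‖ / ‖w‖) := by
  have hw' : 0 < ‖w‖ := norm_pos_iff.2 hw0
  rw [← sub_le_iff_le_add]
  refine le_lowerNorm fun x => le_of_mul_le_mul_left ?_ hw'
  rw [sub_mul, mul_sub, sub_le_iff_le_add, mul_left_comm]
  refine (hB.iInf_lowerNorm_window_mul_le hw x).trans_eq ?_
  rw [Finset.sum_mul, Finset.mul_sum]
  congr 1
  refine Finset.sum_congr rfl fun s _ => ?_
  field_simp

end Translates

section SineWeight

lemma norm_shift_neg_sub (s : ℤ) (w : EllTwo ℂ) : ‖shift (-s) w - w‖ = ‖shift s w - w‖ := by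
  have hshift : shift s (shift (-s) w - w) = w - shift s w := by
    ext j
    simp [shift_apply]
  rw [← (shift s).norm_map, hshift, norm_sub_rev]

lemma inner_shift_neg (s : ℤ) (w : EllTwo ℂ) :
    inner ℂ (shift (-s) w) w = inner ℂ w (shift s w) := by
  have hshift : shift s (shift (-s) w) = w := by
    ext j
    simp [shift_apply]
  rw [← (shift s).inner_map_map, hshift]

/-- The weight `m ↦ sin (π m / (n + 1))` on `{1, …, n}`, extended by zero: the ground state of the
discrete Dirichlet Laplacian on this interval. -/
def sineWeight (n : ℕ) : EllTwo ℂ :=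
  ⟨fun m => if 1 ≤ m ∧ m ≤ n then (Real.sin (Real.pi / (n + 1) * m) : ℂ) else 0,
    (memℓp_zero <| (Set.finite_Icc 1 (n : ℤ)).subset fun m hm => by
      by_contra h
      exact hm (if_neg h)).of_exponent_ge zero_le⟩

lemma sineWeight_apply_of_mem {n : ℕ} {m : ℤ} (h0 : 0 ≤ m) (h1 : m ≤ n + 1) :
    sineWeight n m = Real.sin (Real.pi / (n + 1) * m) := by
  by_cases hm : 1 ≤ m ∧ m ≤ n
  · exact if_pos hm
  rw [show sineWeight n m = 0 from if_neg hm]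
  obtain rfl | rfl : m = 0 ∨ m = n + 1 := by omega
  · simp
  · have : (n : ℝ) + 1 ≠ 0 := by positivity
    rw [Int.cast_add, Int.cast_natCast, Int.cast_one, div_mul_cancel₀ _ this, Real.sin_pi,
      Complex.ofReal_zero]

lemma sineWeight_mem_window (n : ℕ) : sineWeight n ∈ window ℂ n 0 := fun _ hm =>
  if_neg (by simpa only [zero_add] using hm)

lemma sineWeight_ne_zero {n : ℕ} (hn : 0 < n) : sineWeight n ≠ 0 := by
  have hn' : (0 : ℝ) < n := by exact_mod_cast hn
  have hsin : 0 < Real.sin (Real.pi / (n + 1)) :=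
    Real.sin_pos_of_pos_of_lt_pi (by positivity) (div_lt_self Real.pi_pos (by linarith))
  intro h
  have h1 := sineWeight_apply_of_mem (n := n) (m := 1) (by norm_num) (by omega)
  rw [h, Int.cast_one, mul_one] at h1
  exact hsin.ne (Complex.ofReal_injective h1)

lemma sineWeight_sub_add_sineWeight_add {n : ℕ} {m : ℤ} (h1 : 1 ≤ m) (hn : m ≤ n) :
    sineWeight n (m - 1) + sineWeight n (m + 1) =
      (2 * Real.cos (Real.pi / (n + 1)) : ℝ) * sineWeight n m := by
  rw [sineWeight_apply_of_mem (by omega) (by omega), sineWeight_apply_of_mem (by omega) (by omega),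
    sineWeight_apply_of_mem (by omega) (by omega)]
  rw [← Complex.ofReal_add, ← Complex.ofReal_mul, Int.cast_sub, Int.cast_add, Int.cast_one, mul_sub,
    mul_add, mul_one, Real.sin_sub, Real.sin_add]
  ring_nf

lemma inner_shift_add_shift_sineWeight (n : ℕ) :
    inner ℂ (shift 1 (sineWeight n) + shift (-1) (sineWeight n)) (sineWeight n) =
      (2 * Real.cos (Real.pi / (n + 1)) : ℝ) * inner ℂ (sineWeight n) (sineWeight n) := by
  rw [lp.inner_eq_tsum, lp.inner_eq_tsum, ← tsum_mul_left]
  refine tsum_congr fun m => ?_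
  by_cases hm : 1 ≤ m ∧ m ≤ n
  · rw [lp.coeFn_add, Pi.add_apply, shift_apply, shift_apply, sub_neg_eq_add,
      sineWeight_sub_add_sineWeight_add hm.1 hm.2, ← smul_eq_mul, inner_smul_left,
      Complex.conj_ofReal]
  · rw [show sineWeight n m = 0 from if_neg hm, inner_zero_right, inner_zero_right, mul_zero]

lemma norm_shift_one_sineWeight_sub (n : ℕ) :
    ‖shift 1 (sineWeight n) - sineWeight n‖ =
      2 * Real.sin (Real.pi / (2 * (n + 1))) * ‖sineWeight n‖ := by
  set w := sineWeight n
  have hre : RCLike.re (inner ℂ (shift 1 w) w) = Real.cos (Real.pi / (n + 1)) * ‖w‖ ^ 2 := by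
    have h : RCLike.re (inner ℂ (shift 1 w + shift (-1) w) w) =
        2 * Real.cos (Real.pi / (n + 1)) * RCLike.re (inner ℂ w w) := by
      rw [inner_shift_add_shift_sineWeight]
      exact RCLike.re_ofReal_mul _ _
    rw [inner_add_left, inner_shift_neg, map_add, inner_re_symm w (shift 1 w),
      inner_self_eq_norm_sq] at h
    linarith
  have hcos : Real.cos (Real.pi / (n + 1)) = 1 - 2 * Real.sin (Real.pi / (2 * (n + 1))) ^ 2 := by
    rw [← Real.cos_two_mul_eq_one_sub]
    congr 1
    field_simp
  refine (sq_eq_sq₀ (norm_nonneg _)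
    (mul_nonneg (mul_nonneg zero_le_two (sin_pi_div_nonneg n)) (norm_nonneg _))).1 ?_
  rw [@norm_sub_sq ℂ, hre, hcos, LinearIsometryEquiv.norm_map]
  ring

theorem IsBandedWith.iInf_lowerNorm_window_le_add_penalty {Y : Type*} [NormedAddCommGroup Y]
    [NormedSpace ℂ Y] [Nontrivial Y] {B : EllTwo Y →L[ℂ] EllTwo Y} (hB : IsBandedWith B 1)
    {n : ℕ} (hn : 0 < n) :
    ⨅ k, lowerNorm (B.comp (window Y n k).subtypeL) ≤ lowerNorm B + penalty n B := by
  have hw0 : ‖sineWeight n‖ ≠ 0 := norm_ne_zero_iff.2 (sineWeight_ne_zero hn)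
  refine (hB.iInf_lowerNorm_window_le (sineWeight_mem_window n) (sineWeight_ne_zero hn)).trans_eq ?_
  have hzero : ‖shift 0 (sineWeight n) - sineWeight n‖ = 0 := by
    rw [norm_eq_zero, sub_eq_zero]
    ext j
    simp [shift_apply]
  rw [show Finset.Icc (-((1 : ℕ) : ℤ)) (1 : ℕ) = {-1, 0, 1} from rfl,
    Finset.sum_insert (by decide), Finset.sum_pair (by decide), norm_shift_neg_sub, hzero,
    norm_shift_one_sineWeight_sub, mul_div_cancel_right₀ _ hw0, penalty, rBound]
  simp only [← sub_eq_add_neg]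
  ring

end SineWeight

/-! ### Accuracy of one-sided truncation -/

section Truncation

variable {Y : Type*} [NormedAddCommGroup Y] [NormedSpace ℂ Y] {n : ℕ}

lemma nontrivial_window [Nontrivial Y] (hn : 0 < n) (k : ℤ) : Nontrivial (window Y n k) := by
  obtain ⟨y, hy⟩ := exists_ne (0 : Y)
  have hmem : lp.single 2 (k + 1) y ∈ window Y n k := fun j hj =>
    lp.single_apply_ne _ _ _ (by omega)
  refine nontrivial_of_ne ⟨_, hmem⟩ 0 (norm_ne_zero_iff.1 ?_)
  rwa [Submodule.coe_norm, lp.norm_single (by norm_num), norm_ne_zero_iff]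

lemma lowerNorm_adjoint (B : EllTwo Y →L[ℂ] EllTwo Y) :
    lowerNorm (adjoint B) = lowerNorm (dualMap B) :=
  lowerNorm_conj (dualIso Y) (dualMap B)

lemma muTrunc_le_lowerNorm_window (n : ℕ) (B : EllTwo Y →L[ℂ] EllTwo Y) (k : ℤ) :
    muTrunc n B ≤ min (lowerNorm (B.comp (window Y n k).subtypeL))
      (lowerNorm ((adjoint B).comp (window (StrongDual ℂ Y) n k).subtypeL)) :=
  ciInf_le ⟨0, Set.forall_mem_range.2 fun _ => le_min (lowerNorm_nonneg _) (lowerNorm_nonneg _)⟩ k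

variable [CompleteSpace Y] [Nontrivial Y]

lemma recipNormInv_eq_min_adjoint (B : EllTwo Y →L[ℂ] EllTwo Y) :
    recipNormInv B = min (lowerNorm B) (lowerNorm (adjoint B)) := by
  rw [recipNormInv_eq_min, lowerNorm_adjoint]

theorem recipNormInv_le_muTrunc (hn : 0 < n) (B : EllTwo Y →L[ℂ] EllTwo Y) :
    recipNormInv B ≤ muTrunc n B := by
  rw [recipNormInv_eq_min_adjoint]
  refine le_ciInf fun k => ?_
  have := nontrivial_window (Y := Y) hn k
  have := nontrivial_window (Y := StrongDual ℂ Y) hn k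
  exact min_le_min (lowerNorm_le_lowerNorm_restrict _ _) (lowerNorm_le_lowerNorm_restrict _ _)

theorem IsBandedWith.muTrunc_le_recipNormInv_add_penalty {B : EllTwo Y →L[ℂ] EllTwo Y}
    (hB : IsBandedWith B 1) (hn : 0 < n) : muTrunc n B ≤ recipNormInv B + penalty n B := by
  have hprimal : muTrunc n B ≤ lowerNorm B + penalty n B :=
    (le_ciInf fun k => (muTrunc_le_lowerNorm_window n B k).trans (min_le_left _ _)).trans
      (hB.iInf_lowerNorm_window_le_add_penalty hn)
  have hdual : muTrunc n B ≤ lowerNorm (BandDominated.adjoint B) + penalty n B :=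
    ((le_ciInf fun k => (muTrunc_le_lowerNorm_window n B k).trans (min_le_right _ _)).trans
      (hB.adjoint.iInf_lowerNorm_window_le_add_penalty hn)).trans
      (add_le_add le_rfl (penalty_adjoint_le n B))
  rw [recipNormInv_eq_min_adjoint, ← min_add_add_right]
  exact le_min hprimal hdual

variable {ε : ℝ}

theorem Gam_subset_Specc (hn : 0 < n) (hε : 0 ≤ ε) (B : EllTwo Y →L[ℂ] EllTwo Y) :
    Gam n ε B ⊆ Specc ε B := fun _ hz =>
  (mem_Specc_iff hε).2 ((recipNormInv_le_muTrunc hn _).trans hz)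

theorem IsBandedWith.Specc_subset_Gam {B : EllTwo Y →L[ℂ] EllTwo Y} (hB : IsBandedWith B 1)
    (hn : 0 < n) (hε : 0 ≤ ε) : Specc ε B ⊆ Gam n (ε + penalty n B) B := fun z hz =>
  ((hB.sub_smul_id z).muTrunc_le_recipNormInv_add_penalty hn).trans <| by
    rw [penalty_sub_smul_id]
    exact add_le_add ((mem_Specc_iff hε).1 hz) le_rfl

end Truncation

/-! ### Block forms -/

section Blocks

variable {X : Type*} [NormedAddCommGroup X]

instance nontrivial_pow [Nontrivial X] (b : ℕ) [NeZero b] : Nontrivial (Pow X b) :=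
  inferInstanceAs (Nontrivial (PiLp 2 fun _ : Fin b => X))

lemma pow_ext {b : ℕ} {ξ η : Pow X b} (h : ∀ m, ξ.get m = η.get m) : ξ = η :=
  congrArg Pow.mk (funext h)

variable [NormedSpace ℂ X] {b c v : ℕ} [NeZero b]

lemma blockForm_eq_conj (b : ℕ) [NeZero b] (B : EllTwo X →L[ℂ] EllTwo X) :
    blockForm b B = (blockIso X b).toContinuousLinearEquiv.conjContinuousAlgEquiv B := rfl

lemma norm_blockForm_le (b : ℕ) [NeZero b] (B : EllTwo X →L[ℂ] EllTwo X) :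
    ‖blockForm b B‖ ≤ ‖B‖ :=
  ContinuousLinearMap.opNorm_le_bound _ (norm_nonneg _) fun ξ => by
    change ‖blockIso X b (B ((blockIso X b).symm ξ))‖ ≤ ‖B‖ * ‖ξ‖
    rw [LinearIsometryEquiv.norm_map, ← (blockIso X b).symm.norm_map ξ]
    exact B.le_opNorm _

lemma get_entry_blockForm (B : EllTwo X →L[ℂ] EllTwo X) (i j : ℤ) (ξ : Pow X b) (m : Fin b) :
    (entry (blockForm b B) i j ξ).get m =
      ∑ m', entry B (blockIndex b (i, m)) (blockIndex b (j, m')) (ξ.get m') := by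
  set x := (blockIso X b).symm (lp.single 2 j ξ)
  have hx (i' : ℤ) (m' : Fin b) :
      x (blockIndex b (i', m')) = ((lp.single 2 j ξ : EllTwo (Pow X b)) i').get m' := by
    change unblockSeq b _ _ = _
    rw [unblockSeq, Equiv.symm_apply_apply]
  have hxj (m' : Fin b) : x (blockIndex b (j, m')) = ξ.get m' := by rw [hx, lp.single_apply_self]
  have hsum := hasSum_entry B x (blockIndex b (i, m))
  rw [← (blockIndex b).hasSum_iff,
    ← (Prod.mk_right_injective j).hasSum_iff fun p hp => ?_] at hsum
  · refine hsum.unique ?_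
    simp only [← hxj]
    exact hasSum_fintype _
  · have hpj : p.1 ≠ j := fun h => hp ⟨p.2, Prod.ext h.symm rfl⟩
    rw [Function.comp_apply, hx p.1 p.2, lp.single_apply_ne _ _ _ hpj]
    exact map_zero _

lemma lt_abs_blockIndex_sub_blockIndex (hv : v ≤ b * c) {i j : ℤ} (hij : (c : ℤ) < |i - j|)
    (m m' : Fin b) : (v : ℤ) < |blockIndex b (i, m) - blockIndex b (j, m')| := by
  rw [blockIndex_apply, blockIndex_apply]
  have hb : (0 : ℤ) < b := by exact_mod_cast NeZero.pos b
  have hv' : (v : ℤ) ≤ b * c := by exact_mod_cast hv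
  have hm := m.2
  have hm' := m'.2
  rw [lt_abs] at hij ⊢
  rcases hij with h | h
  · left
    nlinarith
  · right
    nlinarith

theorem IsBandedWith.blockForm {B : EllTwo X →L[ℂ] EllTwo X} (hB : IsBandedWith B v)
    (hv : v ≤ b * c) : IsBandedWith (blockForm b B) c := by
  intro i j hij
  ext ξ : 1
  refine pow_ext fun m => ?_
  rw [get_entry_blockForm]
  exact Finset.sum_eq_zero fun m' _ => by
    rw [hB _ _ (lt_abs_blockIndex_sub_blockIndex hv hij m m')]
    rfl

variable {ε : ℝ}

lemma Specc_blockForm [Nontrivial X] (hε : 0 ≤ ε) (b : ℕ) [NeZero b]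
    (B : EllTwo X →L[ℂ] EllTwo X) : Specc ε (blockForm b B) = Specc ε B := by
  rw [blockForm_eq_conj, Specc_conj hε]

end Blocks

/-! ### Approximation by banded operators -/

section Approximation

lemma tendsto_sin_pi_div :
    Tendsto (fun n : ℕ => Real.sin (Real.pi / (2 * ((n : ℝ) + 1)))) atTop (𝓝 0) := by
  have hden : Tendsto (fun n : ℕ => 2 * ((n : ℝ) + 1)) atTop atTop :=
    (tendsto_atTop_add_const_right _ 1 tendsto_natCast_atTop_atTop).const_mul_atTop two_pos
  simpa only [Real.sin_zero, Function.comp_def] using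
    (Real.continuous_sin.tendsto 0).comp (hden.const_div_atTop Real.pi)

lemma tendsto_penalty {ι : Type*} {l : Filter ι} {n : ι → ℕ} (hn : Tendsto n l atTop)
    {Y : ι → Type*} [∀ i, NormedAddCommGroup (Y i)] [∀ i, NormedSpace ℂ (Y i)]
    {B : ∀ i, EllTwo (Y i) →L[ℂ] EllTwo (Y i)} {M : ℝ} (hB : ∀ᶠ i in l, ‖B i‖ ≤ M) :
    Tendsto (fun i => penalty (n i) (B i)) l (𝓝 0) := by
  have hbound : Tendsto (fun i => 2 * (2 * M) * Real.sin (Real.pi / (2 * ((n i : ℝ) + 1)))) l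
      (𝓝 0) := by
    simpa only [mul_zero, Function.comp_def] using
      (tendsto_sin_pi_div.comp hn).const_mul (2 * (2 * M))
  refine squeeze_zero' (.of_forall fun i => penalty_nonneg _ _) (hB.mono fun i hi => ?_) hbound
  have hr : rBound (B i) ≤ 2 * M := (rBound_le_two_mul_norm _).trans (by gcongr)
  exact mul_le_mul_of_nonneg_right (by gcongr) (sin_pi_div_nonneg _)

variable {X : Type*} [NormedAddCommGroup X] [NormedSpace ℂ X]

lemma tendsto_penalty_blockForm {A : EllTwo X →L[ℂ] EllTwo X}
    {A' : ℕ+ → (EllTwo X →L[ℂ] EllTwo X)} (hδ : Tendsto (fun n => ‖A - A' n‖) atTop (𝓝 0))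
    (w : ℕ+ → ℕ+) :
    Tendsto (fun n : ℕ+ => penalty n (blockForm (w n) (A' n))) atTop (𝓝 0) := by
  refine tendsto_penalty (M := ‖A‖ + 1) tendsto_PNat_val_atTop_atTop ?_
  filter_upwards [hδ.eventually_le_const one_pos] with n hn
  calc ‖blockForm (w n) (A' n)‖ ≤ ‖A' n‖ := norm_blockForm_le _ _
    _ ≤ ‖A‖ + ‖A - A' n‖ := norm_le_norm_add_norm_sub A (A' n)
    _ ≤ ‖A‖ + 1 := by gcongr

variable [CompleteSpace X] [Nontrivial X] {b n : ℕ} [NeZero b] {ε : ℝ}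

theorem IsBandedWith.Specc_subset_Gam_blockForm {B : EllTwo X →L[ℂ] EllTwo X}
    (hB : IsBandedWith B b) (hn : 0 < n) (hε : 0 ≤ ε) (A : EllTwo X →L[ℂ] EllTwo X) :
    Specc ε A ⊆
      Gam n (ε + ‖A - B‖ + penalty n (BandDominated.blockForm b B))
        (BandDominated.blockForm b B) := by
  have hδ : 0 ≤ ε + ‖A - B‖ := by positivity
  calc Specc ε A ⊆ Specc (ε + ‖A - B‖) B := Specc_subset_Specc_add_norm_sub hε A B
    _ = Specc (ε + ‖A - B‖) (BandDominated.blockForm b B) := (Specc_blockForm hδ b B).symm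
    _ ⊆ _ := (hB.blockForm (mul_one b).ge).Specc_subset_Gam hn hδ

theorem Gam_blockForm_subset_Specc (hn : 0 < n) (hε : 0 ≤ ε) (A B : EllTwo X →L[ℂ] EllTwo X) :
    Gam n (ε + ‖A - B‖ + penalty n (blockForm b B)) (blockForm b B) ⊆
      Specc (ε + 2 * ‖A - B‖ + penalty n (blockForm b B)) A := by
  have hη : 0 ≤ ε + ‖A - B‖ + penalty n (blockForm b B) :=
    add_nonneg (by positivity) (penalty_nonneg n _)
  have hradius : ε + ‖A - B‖ + penalty n (blockForm b B) + ‖B - A‖ =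
      ε + 2 * ‖A - B‖ + penalty n (blockForm b B) := by
    rw [norm_sub_rev B A]
    ring
  calc Gam n (ε + ‖A - B‖ + penalty n (blockForm b B)) (blockForm b B)
      ⊆ Specc (ε + ‖A - B‖ + penalty n (blockForm b B)) (blockForm b B) :=
        Gam_subset_Specc hn hη _
    _ = Specc (ε + ‖A - B‖ + penalty n (blockForm b B)) B := Specc_blockForm hη b B
    _ ⊆ Specc (ε + ‖A - B‖ + penalty n (blockForm b B) + ‖B - A‖) A :=
        Specc_subset_Specc_add_norm_sub hη B A
    _ = _ := by rw [hradius]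

end Approximation

end BandDominated

end

theorem theorem1p6_general {X : Type*} [NormedAddCommGroup X] [NormedSpace ℂ X] [CompleteSpace X]
    [Nontrivial X] (A : EllTwo X →L[ℂ] EllTwo X)
    (A' : ℕ+ → (EllTwo X →L[ℂ] EllTwo X)) (w : ℕ+ → ℕ+)
    (hw : ∀ n, IsBandedWith (A' n) (w n))
    (hδ : Tendsto (fun n => ‖A - A' n‖) atTop (𝓝 0)) :
    (∀ n, IsBandedWith (blockForm (w n) (A' n)) 1) ∧
    (∀ ε : ℝ, 0 ≤ ε →
      (∀ n : ℕ+,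
        Specc ε A ⊆
          Gam n (ε + ‖A - A' n‖ + penalty n (blockForm (w n) (A' n))) (blockForm (w n) (A' n)) ∧
        Gam n (ε + ‖A - A' n‖ + penalty n (blockForm (w n) (A' n))) (blockForm (w n) (A' n)) ⊆
          Specc (ε + 2 * ‖A - A' n‖ + penalty n (blockForm (w n) (A' n))) A) ∧
      HausdorffTendsto
        (fun n => Gam n (ε + ‖A - A' n‖ + penalty n (blockForm (w n) (A' n)))
          (blockForm (w n) (A' n)))
        (Specc ε A)) ∧
    HausdorffTendsto
      (fun n => Gam n (‖A - A' n‖ + penalty n (blockForm (w n) (A' n)))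
        (blockForm (w n) (A' n)))
      (spectrum ℂ A) := by
  have hlower {ε : ℝ} (hε : 0 ≤ ε) (n : ℕ+) := (hw n).Specc_subset_Gam_blockForm n.pos hε A
  have hupper {ε : ℝ} (hε : 0 ≤ ε) (n : ℕ+) :=
    Gam_blockForm_subset_Specc (b := w n) n.pos hε A (A' n)
  have hradius : Tendsto
      (fun n : ℕ+ => 2 * ‖A - A' n‖ + penalty n (blockForm (w n) (A' n))) atTop (𝓝 0) := by
    simpa only [mul_zero, add_zero] using (hδ.const_mul 2).add (tendsto_penalty_blockForm hδ w)
  have hconv {ε : ℝ} (hε : 0 ≤ ε) := hausdorffTendsto_Specc hε A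
    (fun n => add_nonneg (by positivity) (penalty_nonneg _ _)) hradius (hlower hε)
    fun n => (hupper hε n).trans_eq (by rw [add_assoc])
  refine ⟨fun n => (hw n).blockForm (mul_one _).ge,
    fun ε hε => ⟨fun n => ⟨hlower hε n, hupper hε n⟩, hconv hε⟩, ?_⟩
  simpa only [zero_add, Specc_zero] using hconv le_rfl

theorem theorem1p6 {X : Type*} [NormedAddCommGroup X] [NormedSpace ℂ X] [CompleteSpace X]
    [Nontrivial X] (hX : FiniteDimensional ℂ X ∨ IsHilbertNorm X)
    (A : EllTwo X →L[ℂ] EllTwo X) (hA : A ∈ BDO X)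
    (A' : ℕ+ → (EllTwo X →L[ℂ] EllTwo X)) (w : ℕ+ → ℕ+)
    (hw : ∀ n, IsBandedWith (A' n) (w n))
    (hδ : Tendsto (fun n => ‖A - A' n‖) atTop (𝓝 0)) :
    (∀ n, IsBandedWith (blockForm (w n) (A' n)) 1) ∧
    (∀ ε : ℝ, 0 ≤ ε →
      (∀ n : ℕ+,
        Specc ε A ⊆
          Gam n (ε + ‖A - A' n‖ + penalty n (blockForm (w n) (A' n))) (blockForm (w n) (A' n)) ∧
        Gam n (ε + ‖A - A' n‖ + penalty n (blockForm (w n) (A' n))) (blockForm (w n) (A' n)) ⊆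
          Specc (ε + 2 * ‖A - A' n‖ + penalty n (blockForm (w n) (A' n))) A) ∧
      HausdorffTendsto
        (fun n => Gam n (ε + ‖A - A' n‖ + penalty n (blockForm (w n) (A' n)))
          (blockForm (w n) (A' n)))
        (Specc ε A)) ∧
    HausdorffTendsto
      (fun n => Gam n (‖A - A' n‖ + penalty n (blockForm (w n) (A' n)))
        (blockForm (w n) (A' n)))
      (spectrum ℂ A) :=
  theorem1p6_general A A' w hw hδ
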